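/- Let $(\Theta,\mathcal T)$ and $(\Omega,\mathcal F)$ be measurable spaces and let $(\mathbb P_\theta)_{\theta\in\Theta}$ be a transition kernel of probability measures from $\Theta$ to $\Omega$, with expectation $\mathbb E_\theta$ and law $\mathcal L_\theta$. A random variable is a measurable function $X:\Theta\times\Omega\to\mathbb R$, also written $X(\theta,\cdot)$ when $\theta$ is fixed. Let $Y$ be a random variable with $\mathbb E_\theta Y^2<\infty$ for all $\theta\in\Theta$; put $\mu_\theta=\mathbb E_\theta Y$, $\sigma_\theta^2=\operatorname{Var}_\theta Y$, and $W=(Y-\mu_\theta)/\sigma_\theta$ if $\sigma_\theta>0$, $W=0$ otherwise. Assume the following. (Z1) $r:\Theta\to(0,\infty)$ is measurable, $\overline r>0$, and $\operatorname{Var}_\theta Y>0$ for all $\theta\in\Theta_0:=\{\theta\in\Theta: r_\theta>\overline r\}$. (Z2) $W^*$ is a random variable such that, for each $\theta\in\Theta_0$, $W^*$ has under $\mathbb P_\theta$ the $W$-zero-biased distribution: $\mathbb E_\theta\{Wf(W)\}=\operatorname{Var}_\theta(W)\,\mathbb E_\theta\{f'(W^*)\}$ for all locally absolutely continuous $f:\mathbb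 R\to\mathbb R$ for which both expectations exist. (Z3) Let $D=W^*-W$. For each $\theta\in\Theta_0$, $\mathcal F_\theta\subset\mathcal F$ is a sub-$\sigma$-algebra and $F_{\theta,1}\in\mathcal F$ is an event (not necessarily in $\mathcal F_\theta$); $\overline D$ is a random variable such that, for each $\theta\in\Theta_0$, $\overline D(\theta,\cdot)$ is $\mathcal F_\theta$-measurable, $\overline D\ge 0$ $\mathbb P_\theta$-almost surely, $|D|\le\overline D$ almost surely on $F_{\theta,1}$, and $$\sup_{\theta\in\Theta_0} r_\theta^2\,\mathbb E_\theta\{|D|(1-I_{F_{\theta,1}})\}<\infty,\qquad \sup_{\theta\in\Theta_0} r_\theta\,\mathbb E_\theta\{|DW|+\overline D\}<\infty.$$ (Z4) $V$ is a random variable and $\Psi:\Theta\times\Omega\to\Theta$ is measurable, with $\Psi(\theta,\cdot)$ $\mathcal F_\theta$-measurable for each $\theta\in\Theta_0$; for each $\theta\in\Theta_0$, $F_{\theta,2}\in\mathcal F_\theta$ is an event such that $\mathcal L_\theta(V\mid\mathcal F_\theta)=\mathcal L_{\Psi}(Y)$ on $F_{\theta,2}$, that is, $\mathbb P_\theta[V\in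 A\mid\mathcal F_\theta](\omega)=\mathbb P_{\Psi(\theta,\omega)}[Y\in A]$ for every Borel set $A$ and $\mathbb P_\theta$-almost every $\omega\in F_{\theta,2}$; and $\sup_{\theta\in\Theta_0} r_\theta^2\,\mathbb E_\theta\{|D|(1-I_{F_{\theta,2}})\}<\infty$. (Z5) $\overline B$ is a random variable such that, for each $\theta\in\Theta_0$, $\overline B(\theta,\cdot)$ is $\mathcal F_\theta$-measurable, $\overline B\ge 0$ $\mathbb P_\theta$-almost surely, $\sigma_\theta^{-1}|Y-V|\le\overline B$ almost surely on $F_{\theta,1}$, and $$\sup_{\theta\in\Theta_0} r_\theta^2\,\mathbb E_\theta\{\overline D(\overline B+\overline D)I_{F_{\theta,2}}\}<\infty.$$ (G7) With essential suprema taken with respect to $\mathbb P_\theta$, $$\sup_{\theta\in\Theta_0}\ \operatorname*{ess\,sup}_{\omega\in F_{\theta,2}\cap\{\Psi\in\Theta_0\}}\frac{\sigma_\theta^2}{\sigma_{\Psi(\theta,\omega)}^2}<\infty,\quad \sup_{\theta\in\Theta_0}\ \operatorname*{ess\,sup}_{\omega\in F_{\theta,2}}\frac{r_\theta}{r_{\Psi(\theta,\omega)}}<\infty,\quad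 \sup_{\theta\in\Theta_0}\ \operatorname*{ess\,sup}_{\omega\in F_{\theta,2}\cap\{\Psi\in\Theta_0\}}\frac{r_{\Psi(\theta,\omega)}}{r_\theta}<\infty.$$ Then there exists a constant $C$, independent of $\theta$, such that, with $Z$ a standard normal random variable, $$\sup_{z\in\mathbb R}\bigl|\mathbb P_\theta[W\le z]-\mathbb P[Z\le z]\bigr|\le\frac{C}{r_\theta}\qquad\text{for all }\theta\in\Theta.$$ -/

import Mathlib

open MeasureTheory ProbabilityTheory

open scoped ENNReal

noncomputable section

/-- The mean `μ_θ = E_θ Y` of the random variable `Y` under the kernel `P`. -/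
def meanAt {Θ Ω : Type*} [MeasurableSpace Θ] [MeasurableSpace Ω]
    (P : Kernel Θ Ω) (Y : Θ → Ω → ℝ) (θ : Θ) : ℝ :=
  ∫ ω, Y θ ω ∂(P θ)

/-- The variance `σ_θ² = Var_θ Y`. -/
def varAt {Θ Ω : Type*} [MeasurableSpace Θ] [MeasurableSpace Ω]
    (P : Kernel Θ Ω) (Y : Θ → Ω → ℝ) (θ : Θ) : ℝ :=
  variance (Y θ) (P θ)

/-- The standard deviation `σ_θ`. -/
def sdAt {Θ Ω : Type*} [MeasurableSpace Θ] [MeasurableSpace Ω]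
    (P : Kernel Θ Ω) (Y : Θ → Ω → ℝ) (θ : Θ) : ℝ :=
  Real.sqrt (varAt P Y θ)

/-- The standardized variable: `W = (Y - μ_θ) / σ_θ` if `σ_θ > 0`, and `W = 0` otherwise. -/
def standardized {Θ Ω : Type*} [MeasurableSpace Θ] [MeasurableSpace Ω]
    (P : Kernel Θ Ω) (Y : Θ → Ω → ℝ) (θ : Θ) (ω : Ω) : ℝ :=
  if 0 < sdAt P Y θ then (Y θ ω - meanAt P Y θ) / sdAt P Y θ else 0

/-- The set of parameters on which the rate function exceeds the threshold. -/
def goodSet {Θ : Type*} (r : Θ → ℝ) (rbar : ℝ) : Set Θ :=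
  {θ | rbar < r θ}

/-- `Wstar` has the `W`-zero-biased distribution under `μ` (for `W` of mean zero and finite
positive variance): `E[W f(W)] = Var(W) E[f'(Wstar)]` for all locally absolutely continuous
functions `f` for which both expectations exist. -/
def IsZeroBias {Ω : Type*} [MeasurableSpace Ω] (μ : Measure Ω) (W Wstar : Ω → ℝ) : Prop :=
  ∀ f : ℝ → ℝ, (∀ a b : ℝ, AbsolutelyContinuousOnInterval f a b) →
    Integrable (fun ω => W ω * f (W ω)) μ →
    Integrable (fun ω => deriv f (Wstar ω)) μ →
    ∫ ω, W ω * f (W ω) ∂μ = variance W μ * ∫ ω, deriv f (Wstar ω) ∂μ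

/-- The Kolmogorov distance between the law of `X` under `μ` and the standard normal law. -/
def kolmogorovToNormal {Ω : Type*} [MeasurableSpace Ω] (μ : Measure Ω) (X : Ω → ℝ) : ℝ :=
  ⨆ z : ℝ, |μ.real {ω | X ω ≤ z} - (gaussianReal 0 1).real (Set.Iic z)|

end

/-! Stein's method with a zero-bias coupling, closed by a recursion over the parameter. Write `D =
Wstar - W` and let `h` be a ramp of width `l` replacing the indicator of `(-∞, z]`. If `f` solves
Stein's equation `f' w = w f w + h w - N h`, the zero-bias identity turns `E h(W) - N h` into `E
(f'(W) - f'(Wstar))`. Substituting the equation for `f'` leaves terms bounded by `|D W|` and `|D|`,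
which are of order `1 / r θ`, and the difference `h(Wstar) - h(W)`.

That difference is at most `Dbar / l` on the event that `W` lies within `Dbar` of `[z, z + l]`,
apart from the exceptional sets. On this event `V` lies in an interval with `ℱ θ`-measurable
endpoints. Given `ℱ θ`, `V` has the law of `Y` at the random parameter `Ψ`, so the conditional
probability of the interval is at most twice the Kolmogorov distance `δ` at `Ψ` plus a multiple of
the interval's standardized length and a further `l`. With `M` bounding `δ` at the parameters
reached by `Ψ`, this gives `δ θ ≲ l + 1 / r θ + (1 / (l r θ)) (M + l + 1 / r θ)`
(`kolmogorovToNormal_le_of_zeroBias_coupling`).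

Taking `l = K / r θ` with `K` large makes the coefficient of the unknown small enough for a
contraction in `r θ * δ θ`. Since that quantity is not known in advance to be bounded, `r` is
truncated at a level `R`, and the resulting bound does not depend on `R`
(`exists_rate_of_truncated_recursion`). Parameters of rate at most `rbar` only need `δ ≤ 1`. -/

/-! ### The standard normal density and its tails. -/

lemma hasDerivAt_stdGaussianPDF (x : ℝ) :
    HasDerivAt (gaussianPDFReal 0 1) (-(x * gaussianPDFReal 0 1 x)) x := by
  rw [gaussianPDFReal_def]
  have h : HasDerivAt (fun x : ℝ => -(x - 0) ^ 2 / (2 * ((1 : NNReal) : ℝ))) (-x) x := by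
    have := (((hasDerivAt_id x).sub_const 0).pow 2).neg.div_const (2 * ((1 : NNReal) : ℝ))
    refine this.congr_deriv ?_
    simp
    ring
  refine (h.exp.const_mul _).congr_deriv ?_
  ring

lemma continuous_stdGaussianPDF : Continuous (gaussianPDFReal 0 1) :=
  continuous_iff_continuousAt.2 fun x => (hasDerivAt_stdGaussianPDF x).continuousAt

lemma stdGaussianPDF_neg (x : ℝ) : gaussianPDFReal 0 1 (-x) = gaussianPDFReal 0 1 x := by
  simp [gaussianPDFReal_def]

lemma stdGaussianPDF_le_one (x : ℝ) : gaussianPDFReal 0 1 x ≤ 1 := by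
  rw [gaussianPDFReal_def]
  have h1 : (√(2 * Real.pi * ((1 : NNReal) : ℝ)))⁻¹ ≤ 1 := by
    apply inv_le_one_of_one_le₀
    rw [Real.one_le_sqrt]
    have := Real.pi_gt_three
    simp
    linarith
  have h2 : Real.exp (-(x - 0) ^ 2 / (2 * ((1 : NNReal) : ℝ))) ≤ 1 := by
    rw [Real.exp_le_one_iff]
    simp
    have := sq_nonneg x
    linarith
  exact mul_le_one₀ h1 (Real.exp_pos _).le h2

lemma tendsto_stdGaussianPDF_atTop :
    Filter.Tendsto (gaussianPDFReal 0 1) Filter.atTop (nhds 0) := by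
  rw [gaussianPDFReal_def]
  have h : Filter.Tendsto (fun x : ℝ => -(x - 0) ^ 2 / (2 * ((1 : NNReal) : ℝ)))
      Filter.atTop Filter.atBot := by
    have h1 : Filter.Tendsto (fun x : ℝ => x ^ 2 / 2) Filter.atTop Filter.atTop :=
      (Filter.tendsto_pow_atTop two_ne_zero).atTop_div_const two_pos
    refine (Filter.tendsto_neg_atTop_atBot.comp h1).congr fun x => ?_
    simp [neg_div]
  simpa using (Real.tendsto_exp_atBot.comp h).const_mul (√(2 * Real.pi * ((1 : NNReal) : ℝ)))⁻¹

/-- Mills' inequality for the upper tail of the standard normal law. -/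
lemma mul_integral_Ioi_stdGaussianPDF_le {w : ℝ} (hw : 0 ≤ w) :
    w * ∫ x in Set.Ioi w, gaussianPDFReal 0 1 x ≤ gaussianPDFReal 0 1 w := by
  have hneg : ∀ x ∈ Set.Ioi w, -(x * gaussianPDFReal 0 1 x) ≤ 0 := fun x hx =>
    neg_nonpos.2 (mul_nonneg (hw.trans (le_of_lt hx)) (gaussianPDFReal_nonneg 0 1 x))
  have hint := integrableOn_Ioi_deriv_of_nonpos' (fun x _ => hasDerivAt_stdGaussianPDF x) hneg
    tendsto_stdGaussianPDF_atTop
  have heq := integral_Ioi_of_hasDerivAt_of_nonpos' (fun x _ => hasDerivAt_stdGaussianPDF x) hneg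
    tendsto_stdGaussianPDF_atTop
  rw [integral_neg] at heq
  have hint' : IntegrableOn (fun x => x * gaussianPDFReal 0 1 x) (Set.Ioi w) := by
    simpa using hint.neg
  -- On the tail `w ≤ x`, and `x φ(x) = -φ'(x)` integrates there to exactly `φ(w)`.
  rw [← integral_const_mul]
  have : ∫ x in Set.Ioi w, w * gaussianPDFReal 0 1 x
      ≤ ∫ x in Set.Ioi w, x * gaussianPDFReal 0 1 x :=
    setIntegral_mono_on ((integrable_gaussianPDFReal 0 1).const_mul w).integrableOn hint'
      measurableSet_Ioi fun x hx =>
        mul_le_mul_of_nonneg_right (le_of_lt hx) (gaussianPDFReal_nonneg 0 1 x)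
  linarith

lemma integral_Iic_stdGaussianPDF (w : ℝ) :
    ∫ x in Set.Iic w, gaussianPDFReal 0 1 x = ∫ x in Set.Ioi (-w), gaussianPDFReal 0 1 x := by
  rw [← integral_comp_neg_Iic]
  simp_rw [stdGaussianPDF_neg]

lemma setIntegral_stdGaussianPDF_le_one (s : Set ℝ) :
    ∫ x in s, gaussianPDFReal 0 1 x ≤ 1 := by
  rw [← integral_gaussianPDFReal_eq_one 0 (one_ne_zero (α := NNReal))]
  exact setIntegral_le_integral (integrable_gaussianPDFReal 0 1)
    (Filter.Eventually.of_forall fun x => gaussianPDFReal_nonneg 0 1 x)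

lemma one_le_six_mul_stdGaussianPDF {w : ℝ} (hw : |w| ≤ 1) : 1 ≤ 6 * gaussianPDFReal 0 1 w := by
  rw [gaussianPDFReal_def]
  have h1 : √(2 * Real.pi * ((1 : NNReal) : ℝ)) ≤ 2.6 := by
    rw [Real.sqrt_le_iff]
    have := Real.pi_lt_d2
    constructor <;> norm_num
    linarith
  have h0 : 0 < √(2 * Real.pi * ((1 : NNReal) : ℝ)) := by
    have := Real.pi_pos
    simp
    positivity
  have h2 : (0.5 : ℝ) ≤ Real.exp (-(w - 0) ^ 2 / (2 * ((1 : NNReal) : ℝ))) := by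
    have h3 := Real.add_one_le_exp (-(w - 0) ^ 2 / (2 * ((1 : NNReal) : ℝ)))
    have h4 : w ^ 2 ≤ 1 := (sq_le_one_iff_abs_le_one w).2 hw
    simp at h3 ⊢
    linarith
  have h5 : (2.6 : ℝ)⁻¹ ≤ (√(2 * Real.pi * ((1 : NNReal) : ℝ)))⁻¹ := inv_anti₀ h0 h1
  have h6 := mul_le_mul h5 h2 (by norm_num) (by positivity)
  simp only
  norm_num at h6 ⊢
  linarith

/-! ### Stein's equation. -/

/-- The solution `f` of the Stein equation `f' w = w f w + h w - N h` for a continuous `h` with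
values in `[0, 1]`, with uniform bounds on `f` and on `f'`. -/
lemma exists_stein_solution {h : ℝ → ℝ} (hc : Continuous h) (h0 : ∀ x, 0 ≤ h x)
    (h1 : ∀ x, h x ≤ 1) :
    ∃ f f' : ℝ → ℝ, (∀ w, HasDerivAt f (f' w) w) ∧
      (∀ w, f' w = w * f w + (h w - ∫ x, h x ∂(gaussianReal 0 1))) ∧
      (∀ w, |f w| ≤ 6) ∧ ∀ w, |f' w| ≤ 2 := by
  set N := ∫ x, h x ∂(gaussianReal 0 1) with hN
  have hφ0 := gaussianPDFReal_nonneg 0 1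
  have hφ : ∀ w, 0 < gaussianPDFReal 0 1 w := fun w => gaussianPDFReal_pos 0 1 w one_ne_zero
  have hφi := integrable_gaussianPDFReal 0 1
  have hhi : Integrable h (gaussianReal 0 1) :=
    Integrable.of_bound hc.aestronglyMeasurable 1 (Filter.Eventually.of_forall fun x => by
      rw [Real.norm_eq_abs, abs_of_nonneg (h0 x)]; exact h1 x)
  have hN0 : 0 ≤ N := integral_nonneg h0
  have hN1 : N ≤ 1 := by
    have := integral_mono hhi (integrable_const (1 : ℝ)) h1
    simpa using this
  have hd : ∀ x, |h x - N| ≤ 1 := fun x => by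
    rw [abs_le]; constructor <;> linarith [h0 x, h1 x]
  set g : ℝ → ℝ := fun x => (h x - N) * gaussianPDFReal 0 1 x with hg
  have hgc : Continuous g := (hc.sub continuous_const).mul continuous_stdGaussianPDF
  have hgle : ∀ x, |g x| ≤ gaussianPDFReal 0 1 x := fun x => by
    rw [hg, abs_mul, abs_of_nonneg (hφ0 x)]
    exact mul_le_of_le_one_left (hφ0 x) (hd x)
  have hgi : Integrable g := hφi.mono' hgc.aestronglyMeasurable
    (Filter.Eventually.of_forall hgle)
  have hgtot : ∫ x, g x = 0 := by
    have : ∫ x, (h x - N) ∂(gaussianReal 0 1) = 0 := by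
      rw [integral_sub hhi (integrable_const _)]
      simp [hN]
    rw [integral_gaussianReal_eq_integral_smul one_ne_zero] at this
    rw [← this]
    simp [hg, mul_comm]
  -- The solution is `f = G / φ`, by the integrating factor `φ`. As `g` has total integral zero, `G`
  -- is also minus the upper tail integral, so Mills' inequality applies on either side of the
  -- origin.
  set G : ℝ → ℝ := fun w => ∫ x in Set.Iic w, g x with hG
  have hGd : ∀ w, HasDerivAt G (g w) w := fun w => by
    have hGeq : G = fun u => G 0 + ∫ x in (0 : ℝ)..u, g x := by
      ext u
      rw [← intervalIntegral.integral_Iic_sub_Iic hgi.integrableOn hgi.integrableOn]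
      simp [hG]
    rw [hGeq]
    exact (intervalIntegral.integral_hasDerivAt_right (hgc.intervalIntegrable _ _)
      (hgc.stronglyMeasurableAtFilter _ _) hgc.continuousAt).const_add _
  have hbd : ∀ s : Set ℝ, |∫ x in s, g x| ≤ ∫ x in s, gaussianPDFReal 0 1 x := fun s =>
    (abs_integral_le_integral_abs).trans
      (integral_mono hgi.integrableOn.abs hφi.integrableOn hgle)
  have hGneg : ∀ w, G w = - ∫ x in Set.Ioi w, g x := fun w => by
    have := intervalIntegral.integral_Iic_add_Ioi (b := w) hgi.integrableOn hgi.integrableOn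
    rw [hgtot] at this
    simp only [hG]
    linarith
  have hGw : ∀ w, |w| * |G w| ≤ gaussianPDFReal 0 1 w := fun w => by
    rcases le_total 0 w with hw | hw
    · rw [hGneg, abs_neg, abs_of_nonneg hw]
      exact (mul_le_mul_of_nonneg_left (hbd _) hw).trans (mul_integral_Ioi_stdGaussianPDF_le hw)
    · rw [abs_of_nonpos hw, ← stdGaussianPDF_neg]
      refine (mul_le_mul_of_nonneg_left (hbd _) (neg_nonneg.2 hw)).trans ?_
      rw [integral_Iic_stdGaussianPDF]
      exact mul_integral_Ioi_stdGaussianPDF_le (neg_nonneg.2 hw)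
  -- Near the origin `|G| ≤ 1 ≤ 6 φ`; for `|w| ≥ 1`, already `|G w| ≤ |w| |G w| ≤ φ w`.
  have hG6 : ∀ w, |G w| ≤ 6 * gaussianPDFReal 0 1 w := fun w => by
    rcases le_total |w| 1 with hw | hw
    · exact (hbd _).trans ((setIntegral_stdGaussianPDF_le_one _).trans
        (one_le_six_mul_stdGaussianPDF hw))
    · nlinarith [hGw w, abs_nonneg (G w), hφ w]
  have hwf : ∀ w, |w * (G w / gaussianPDFReal 0 1 w)| ≤ 1 := fun w => by
    rw [abs_mul, abs_div, abs_of_pos (hφ w), ← mul_div_assoc, div_le_one (hφ w)]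
    exact hGw w
  refine ⟨fun w => G w / gaussianPDFReal 0 1 w,
    fun w => w * (G w / gaussianPDFReal 0 1 w) + (h w - N), fun w => ?_, fun w => rfl,
    fun w => ?_, fun w => ?_⟩
  · refine ((hGd w).div (hasDerivAt_stdGaussianPDF w) (hφ w).ne').congr_deriv ?_
    have := (hφ w).ne'
    simp only [hg]
    field_simp
    ring
  · rw [abs_div, abs_of_pos (hφ w), div_le_iff₀ (hφ w)]
    exact hG6 w
  · exact (abs_add_le _ _).trans (by linarith [hwf w, hd w])

/-! ### Smoothing of indicators. -/

/-- The standard normal distribution function is `1`-Lipschitz. -/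
lemma stdGaussian_cdf_sub_le {a b : ℝ} (hab : a ≤ b) :
    (gaussianReal 0 1).real (Set.Iic b) - (gaussianReal 0 1).real (Set.Iic a) ≤ b - a := by
  have h : ∀ s : Set ℝ, (gaussianReal 0 1).real s = ∫ x in s, gaussianPDFReal 0 1 x := fun s => by
    rw [measureReal_def, gaussianReal_apply_eq_integral 0 one_ne_zero, ENNReal.toReal_ofReal]
    exact integral_nonneg fun x => gaussianPDFReal_nonneg 0 1 x
  have hi := integrable_gaussianPDFReal 0 1
  rw [h, h, intervalIntegral.integral_Iic_sub_Iic hi.integrableOn hi.integrableOn]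
  have := intervalIntegral.integral_mono_on hab (hi.intervalIntegrable)
    (intervalIntegrable_const (c := (1 : ℝ))) fun x _ => stdGaussianPDF_le_one x
  simpa using this

/-- The piecewise linear approximation of the indicator of `(-∞, z]`, of slope `-1 / l`. -/
noncomputable def ramp (z l x : ℝ) : ℝ := max 0 (min 1 ((z + l - x) / l))

lemma continuous_ramp (z l : ℝ) : Continuous (ramp z l) := by
  unfold ramp; fun_prop

lemma ramp_nonneg (z l x : ℝ) : 0 ≤ ramp z l x := le_max_left _ _

lemma ramp_le_one (z l x : ℝ) : ramp z l x ≤ 1 := max_le zero_le_one (min_le_left _ _)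

lemma ramp_of_le {z l x : ℝ} (hl : 0 < l) (hx : x ≤ z) : ramp z l x = 1 := by
  have : 1 ≤ (z + l - x) / l := by rw [le_div_iff₀ hl]; linarith
  simp [ramp, this]

lemma ramp_of_ge {z l x : ℝ} (hl : 0 < l) (hx : z + l ≤ x) : ramp z l x = 0 := by
  have : (z + l - x) / l ≤ 0 := div_nonpos_of_nonpos_of_nonneg (by linarith) hl.le
  simp [ramp, this]

lemma abs_ramp_sub_le {z l : ℝ} (hl : 0 < l) (x y : ℝ) :
    |ramp z l y - ramp z l x| ≤ |y - x| / l := by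
  unfold ramp
  refine (abs_max_sub_max_le_max _ _ _ _).trans ?_
  rw [sub_self, abs_zero, max_eq_right (abs_nonneg _)]
  refine (abs_min_sub_min_le_max _ _ _ _).trans ?_
  rw [sub_self, abs_zero, max_eq_right (abs_nonneg _), ← sub_div, abs_div, abs_of_pos hl,
    abs_sub_comm y x]
  apply le_of_eq
  congr 2
  ring

/-- If `x` is farther than `d` from `[z, z + l]`, then `x` and `y` lie on the same flat piece of the
ramp. This localization is what later brings in a concentration probability. -/
lemma abs_ramp_sub_le_indicator {z l d x y : ℝ} (hl : 0 < l) (hd : |y - x| ≤ d) :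
    |ramp z l y - ramp z l x| ≤ |y - x| / l * (Set.Icc (z - d) (z + l + d)).indicator 1 x := by
  have h := abs_le.1 hd
  by_cases hx : x ∈ Set.Icc (z - d) (z + l + d)
  · simpa [hx] using abs_ramp_sub_le hl x y
  · rw [Set.indicator_of_notMem hx, mul_zero]
    rw [Set.mem_Icc, not_and_or, not_le, not_le] at hx
    rcases hx with hx | hx
    · rw [ramp_of_le hl (by linarith), ramp_of_le hl (by linarith)]; simp
    · rw [ramp_of_ge hl (by linarith), ramp_of_ge hl (by linarith)]; simp

/-! ### The zero-bias identity applied to Stein's equation. -/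

lemma abs_integral_sub_gaussian_le_of_isZeroBias {Ω : Type*} [MeasurableSpace Ω] {μ : Measure Ω}
    [IsProbabilityMeasure μ] {W Wstar : Ω → ℝ} (hW : Measurable W) (hWs : Measurable Wstar)
    (hWi : Integrable W μ) (hvar : variance W μ = 1) (hzb : IsZeroBias μ W Wstar)
    {h : ℝ → ℝ} (hc : Continuous h) (h0 : ∀ x, 0 ≤ h x) (h1 : ∀ x, h x ≤ 1) :
    ENNReal.ofReal |∫ ω, h (W ω) ∂μ - ∫ x, h x ∂(gaussianReal 0 1)| ≤
      ∫⁻ ω, ENNReal.ofReal (6 * |Wstar ω - W ω| + 2 * |(Wstar ω - W ω) * W ω|) ∂μ +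
        ∫⁻ ω, ENNReal.ofReal |h (Wstar ω) - h (W ω)| ∂μ := by
  obtain ⟨f, f', hf, hf', hf6, hf2⟩ := exists_stein_solution hc h0 h1
  set N := ∫ x, h x ∂(gaussianReal 0 1)
  have hderiv : deriv f = f' := funext fun w => (hf w).deriv
  have hfd : Differentiable ℝ f := fun w => (hf w).differentiableAt
  have hlip : LipschitzWith 2 f := lipschitzWith_of_nnnorm_deriv_le hfd fun x => by
    rw [hderiv, ← NNReal.coe_le_coe]
    simpa using hf2 x
  have hfm : Measurable f := hfd.continuous.measurable
  have hf'm : Measurable f' := hderiv ▸ measurable_deriv f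
  have hWf : Integrable (fun ω => W ω * f (W ω)) μ :=
    hWi.mul_bdd (c := 6) (hfm.comp hW).aestronglyMeasurable
      (Filter.Eventually.of_forall fun ω => hf6 _)
  have hbd : ∀ X : Ω → ℝ, Measurable X → Integrable (fun ω => f' (X ω)) μ := fun X hX =>
    Integrable.of_bound (hf'm.comp hX).aestronglyMeasurable 2
      (Filter.Eventually.of_forall fun ω => hf2 _)
  have hhi : Integrable (fun ω => h (W ω)) μ :=
    Integrable.of_bound (hc.measurable.comp hW).aestronglyMeasurable 1
      (Filter.Eventually.of_forall fun ω => by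
        rw [Real.norm_eq_abs, abs_of_nonneg (h0 _)]; exact h1 _)
  have key := hzb f (fun a b => (hlip.lipschitzOnWith).absolutelyContinuousOnInterval) hWf
    (by rw [hderiv]; exact hbd _ hWs)
  rw [hvar, one_mul, hderiv] at key
  have heq : ∫ ω, h (W ω) ∂μ - N = ∫ ω, (f' (W ω) - f' (Wstar ω)) ∂μ := by
    rw [integral_sub (hbd _ hW) (hbd _ hWs), ← key, ← integral_sub (hbd _ hW) hWf]
    have : ∫ ω, (h (W ω) - N) ∂μ = ∫ ω, h (W ω) ∂μ - N := by
      rw [integral_sub hhi (integrable_const _)]; simp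
    rw [← this]
    congr 1 with ω
    rw [hf']; ring
  rw [heq, ← lintegral_add_left (by fun_prop)]
  have hle : ENNReal.ofReal |∫ ω, (f' (W ω) - f' (Wstar ω)) ∂μ| ≤
      ∫⁻ ω, ENNReal.ofReal |f' (W ω) - f' (Wstar ω)| ∂μ := by
    have := enorm_integral_le_lintegral_enorm (μ := μ) (fun ω => f' (W ω) - f' (Wstar ω))
    simpa only [Real.enorm_eq_ofReal_abs] using this
  refine hle.trans (lintegral_mono fun ω => ?_)
  rw [← ENNReal.ofReal_add (by positivity) (by positivity)]
  apply ENNReal.ofReal_le_ofReal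
  have hl : |f (Wstar ω) - f (W ω)| ≤ 2 * |Wstar ω - W ω| := by
    simpa [Real.dist_eq] using hlip.dist_le_mul (Wstar ω) (W ω)
  -- Only `f` being bounded and Lipschitz is used on the first two terms; the third keeps the
  -- roughness of `h`.
  have e : f' (W ω) - f' (Wstar ω) = -(W ω * (f (Wstar ω) - f (W ω))) +
      -((Wstar ω - W ω) * f (Wstar ω)) + -(h (Wstar ω) - h (W ω)) := by
    rw [hf', hf']; ring
  rw [e]
  refine (abs_add_three _ _ _).trans ?_
  rw [abs_neg, abs_neg, abs_neg, abs_mul, abs_mul, abs_mul]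
  have p1 := mul_le_mul_of_nonneg_left hl (abs_nonneg (W ω))
  have p2 := mul_le_mul_of_nonneg_left (hf6 (Wstar ω)) (abs_nonneg (Wstar ω - W ω))
  linarith

/-! ### Conditional laws and kernels. -/

/-- The hypothesis on rectangles identifies the joint law of `(p, V)` with `(ν.map p) ⊗ₘ κ`, after
which Tonelli applies. -/
lemma lintegral_comp_prodMk_eq_of_disintegration {α β Ω : Type*} [MeasurableSpace α]
    [MeasurableSpace β] [MeasurableSpace Ω] {ν : Measure Ω} [IsFiniteMeasure ν] {p : Ω → α}
    (hp : Measurable p) {V : Ω → β} (hV : Measurable V) (κ : Kernel α β) [IsSFiniteKernel κ]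
    (H : ∀ S A, MeasurableSet S → MeasurableSet A →
      ν (p ⁻¹' S ∩ V ⁻¹' A) = ∫⁻ ω in p ⁻¹' S, κ (p ω) A ∂ν)
    {g : α × β → ℝ≥0∞} (hg : Measurable g) :
    ∫⁻ ω, g (p ω, V ω) ∂ν = ∫⁻ ω, ∫⁻ y, g (p ω, y) ∂(κ (p ω)) ∂ν := by
  have h : ν.map (fun ω => (p ω, V ω)) = (ν.map p) ⊗ₘ κ := by
    refine Measure.ext_prod fun {S A} hS hA => ?_
    rw [Measure.map_apply (hp.prodMk hV) (hS.prod hA), Measure.compProd_apply_prod hS hA,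
      setLIntegral_map hS (κ.measurable_coe hA) hp, ← H S A hS hA]
    rfl
  rw [← lintegral_map (f := g) hg (hp.prodMk hV), h, Measure.lintegral_compProd hg,
    lintegral_map hg.lintegral_kernel_prod_right' hp]

lemma measurable_ofReal_mul_indicator_Icc {α : Type*} [MeasurableSpace α] {d a b : α → ℝ}
    (hd : Measurable d) (ha : Measurable a) (hb : Measurable b) :
    Measurable (fun q : α × ℝ =>
      ENNReal.ofReal (d q.1) * (Set.Icc (a q.1) (b q.1)).indicator (1 : ℝ → ℝ≥0∞) q.2) := by
  have hs : MeasurableSet {q : α × ℝ | a q.1 ≤ q.2 ∧ q.2 ≤ b q.1} :=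
    (measurableSet_le (ha.comp measurable_fst) measurable_snd).inter
      (measurableSet_le measurable_snd (hb.comp measurable_fst))
  exact ((hd.comp measurable_fst).ennreal_ofReal).mul
    ((measurable_const (a := (1 : ℝ≥0∞))).indicator hs)

/-- If `κ (Ψ ω)` is the conditional law of `V` given `m` on `F`, then, under an integral over `F`,
the event that `V` is in a random `m`-measurable interval may be replaced by its `κ ∘ Ψ`
probability. -/
lemma setLIntegral_mul_indicator_Icc_of_condLaw {Θ Ω : Type*} [MeasurableSpace Θ]
    {m mΩ : MeasurableSpace Ω} (hm : m ≤ mΩ) {μ : Measure Ω} [IsProbabilityMeasure μ]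
    {V d a b : Ω → ℝ} {Ψ : Ω → Θ} {F : Set Ω} (κ : Kernel Θ ℝ) [IsMarkovKernel κ]
    (hV : Measurable V) (hd : Measurable[m] d) (ha : Measurable[m] a) (hb : Measurable[m] b)
    (hΨ : Measurable[m] Ψ) (hF : MeasurableSet[m] F)
    (hlaw : ∀ A : Set ℝ, MeasurableSet A → ∀ᵐ ω ∂μ, ω ∈ F →
      (μ⟦V ⁻¹' A | m⟧) ω = (κ (Ψ ω)).real A) :
    ∫⁻ ω in F, ENNReal.ofReal (d ω) * (Set.Icc (a ω) (b ω)).indicator 1 (V ω) ∂μ =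
      ∫⁻ ω in F, ENNReal.ofReal (d ω) * κ (Ψ ω) (Set.Icc (a ω) (b ω)) ∂μ := by
  -- The null set in `hlaw` depends on `A`, whereas the interval is random. Testing one rectangle at
  -- a time avoids this; `p` is the identity into `(Ω, m)`.
  have H : ∀ S A, MeasurableSet[m] S → MeasurableSet A →
      (μ.restrict F) (id ⁻¹' S ∩ V ⁻¹' A) = ∫⁻ ω in id ⁻¹' S, κ (Ψ ω) A ∂(μ.restrict F) := by
    intro S A hS hA
    have hSF : MeasurableSet[m] (S ∩ F) := hS.inter hF
    have hVA : MeasurableSet (V ⁻¹' A) := hV hA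
    have hint : Integrable (fun ω => (κ (Ψ ω)).real A) μ :=
      Integrable.of_bound
        (((κ.measurable_coe hA).comp (hΨ.mono hm le_rfl)).ennreal_toReal.aestronglyMeasurable) 1
        (Filter.Eventually.of_forall fun ω => by
          rw [Real.norm_eq_abs, abs_of_nonneg measureReal_nonneg]; exact measureReal_le_one)
    have h1 := setIntegral_condExp hm
      ((integrable_const (1 : ℝ)).indicator (μ := μ) hVA) hSF
    rw [Set.preimage_id, Measure.restrict_restrict (hm _ hS),
      Measure.restrict_apply ((hm _ hS).inter hVA)]
    have h2 : ∫ ω in S ∩ F, (μ⟦V ⁻¹' A | m⟧) ω ∂μ = ∫ ω in S ∩ F, (κ (Ψ ω)).real A ∂μ :=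
      setIntegral_congr_ae (hm _ hSF) (by
        filter_upwards [hlaw A hA] with ω h hω using h hω.2)
    rw [h2, setIntegral_indicator hVA, setIntegral_const, smul_eq_mul, mul_one] at h1
    have h3 : S ∩ V ⁻¹' A ∩ F = S ∩ F ∩ V ⁻¹' A := by
      ext; simp only [Set.mem_inter_iff]; tauto
    rw [h3, ← ofReal_measureReal, ← h1, ofReal_integral_eq_lintegral_ofReal hint.integrableOn
      (Filter.Eventually.of_forall fun ω => measureReal_nonneg)]
    exact lintegral_congr fun ω => ofReal_measureReal
  have hg := @measurable_ofReal_mul_indicator_Icc Ω m d a b hd ha hb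
  have := @lintegral_comp_prodMk_eq_of_disintegration Ω ℝ Ω m _ mΩ (μ.restrict F) _ id
    (measurable_id'' hm) V hV (@Kernel.comap _ _ _ _ _ m κ Ψ hΨ) _ H _ hg
  simp only [id] at this
  rw [this]
  refine lintegral_congr fun ω => ?_
  rw [lintegral_const_mul _ (measurable_one.indicator measurableSet_Icc),
    lintegral_indicator_one measurableSet_Icc]
  rfl

/-- Pushing `δ_θ × P θ` forward under the jointly measurable `Y` makes the law of `Y θ` measurable
in `θ`, so that it can be evaluated at a random parameter. -/
lemma exists_law_kernel {Θ Ω : Type*} [MeasurableSpace Θ] [MeasurableSpace Ω]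
    (P : Kernel Θ Ω) [IsMarkovKernel P] {Y : Θ → Ω → ℝ}
    (hY : Measurable (fun p : Θ × Ω => Y p.1 p.2)) :
    ∃ κ : Kernel Θ ℝ, IsMarkovKernel κ ∧
      ∀ θ A, MeasurableSet A → κ θ A = P θ (Y θ ⁻¹' A) := by
  refine ⟨(Kernel.id ×ₖ P).map (fun p : Θ × Ω => Y p.1 p.2), Kernel.IsMarkovKernel.map _ hY,
    fun θ A hA => ?_⟩
  rw [Kernel.map_apply' _ hY _ hA, Kernel.id_prod_apply' _ _ (hY hA)]
  rfl

/-! ### Kolmogorov distance: smoothing and concentration. -/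

lemma kolmogorovToNormal_nonneg {Ω : Type*} [MeasurableSpace Ω] (μ : Measure Ω) (X : Ω → ℝ) :
    0 ≤ kolmogorovToNormal μ X :=
  Real.iSup_nonneg fun _ => abs_nonneg _

section Kolmogorov

variable {Ω : Type*} [MeasurableSpace Ω] {μ : Measure Ω} [IsProbabilityMeasure μ]

lemma abs_measureReal_sub_gaussian_le_one (X : Ω → ℝ) (z : ℝ) :
    |μ.real {ω | X ω ≤ z} - (gaussianReal 0 1).real (Set.Iic z)| ≤ 1 := by
  have h1 : μ.real {ω | X ω ≤ z} ≤ 1 := measureReal_le_one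
  have h2 : 0 ≤ μ.real {ω | X ω ≤ z} := measureReal_nonneg
  have h3 : (gaussianReal 0 1).real (Set.Iic z) ≤ 1 := measureReal_le_one
  have h4 : 0 ≤ (gaussianReal 0 1).real (Set.Iic z) := measureReal_nonneg
  rw [abs_le]
  constructor <;> linarith

lemma kolmogorovToNormal_le_one (X : Ω → ℝ) : kolmogorovToNormal μ X ≤ 1 :=
  ciSup_le (abs_measureReal_sub_gaussian_le_one X)

lemma abs_sub_le_kolmogorovToNormal (X : Ω → ℝ) (z : ℝ) :
    |μ.real {ω | X ω ≤ z} - (gaussianReal 0 1).real (Set.Iic z)| ≤ kolmogorovToNormal μ X :=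
  le_ciSup (f := fun z : ℝ => |μ.real {ω | X ω ≤ z} - (gaussianReal 0 1).real (Set.Iic z)|)
    ⟨1, by rintro _ ⟨z, rfl⟩; exact abs_measureReal_sub_gaussian_le_one X z⟩ z

lemma measureReal_le_integral_ramp {X : Ω → ℝ} (hX : Measurable X) {z l : ℝ} (hl : 0 < l) :
    μ.real {ω | X ω ≤ z} ≤ ∫ ω, ramp z l (X ω) ∂μ := by
  have hs : MeasurableSet {ω | X ω ≤ z} := measurableSet_le hX measurable_const
  rw [← integral_indicator_one hs]
  refine integral_mono ((integrable_const (1 : ℝ)).indicator hs) ?_ fun ω => ?_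
  · exact Integrable.of_bound ((continuous_ramp z l).measurable.comp hX).aestronglyMeasurable 1
      (Filter.Eventually.of_forall fun ω => by
        rw [Real.norm_eq_abs, abs_of_nonneg (ramp_nonneg _ _ _)]; exact ramp_le_one _ _ _)
  · by_cases h : X ω ≤ z
    · simp [ramp_of_le hl h, h]
    · simp [h, ramp_nonneg]

lemma integral_ramp_le_measureReal {X : Ω → ℝ} (hX : Measurable X) {z l : ℝ} (hl : 0 < l) :
    ∫ ω, ramp z l (X ω) ∂μ ≤ μ.real {ω | X ω ≤ z + l} := by
  have hs : MeasurableSet {ω | X ω ≤ z + l} := measurableSet_le hX measurable_const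
  rw [← integral_indicator_one hs]
  refine integral_mono ?_ ((integrable_const (1 : ℝ)).indicator hs) fun ω => ?_
  · exact Integrable.of_bound ((continuous_ramp z l).measurable.comp hX).aestronglyMeasurable 1
      (Filter.Eventually.of_forall fun ω => by
        rw [Real.norm_eq_abs, abs_of_nonneg (ramp_nonneg _ _ _)]; exact ramp_le_one _ _ _)
  · by_cases h : X ω ≤ z + l
    · simp [h, ramp_le_one]
    · simp [h, ramp_of_ge hl (not_le.1 h).le]

/-- The indicator of `(-∞, z]` lies between the ramps starting at `z - l` and at `z`; the shift
costs at most `l` in the normal distribution function. -/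
lemma kolmogorovToNormal_le_of_ramp {X : Ω → ℝ} (hX : Measurable X) {l ε : ℝ} (hl : 0 < l)
    (h : ∀ z, |∫ ω, ramp z l (X ω) ∂μ - ∫ x, ramp z l x ∂(gaussianReal 0 1)| ≤ ε) :
    kolmogorovToNormal μ X ≤ l + ε := by
  refine ciSup_le fun z => ?_
  rw [abs_le]
  constructor
  · have h1 := (abs_le.1 (h (z - l))).1
    have h2 := integral_ramp_le_measureReal (μ := μ) hX (z := z - l) hl
    have h3 := measureReal_le_integral_ramp (μ := gaussianReal 0 1) measurable_id (z := z - l) hl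
    have h4 := stdGaussian_cdf_sub_le (a := z - l) (b := z) (by linarith)
    rw [sub_add_cancel] at h2
    change (gaussianReal 0 1).real (Set.Iic (z - l)) ≤ _ at h3
    simp only [id] at h3
    linarith
  · have h1 := (abs_le.1 (h z)).2
    have h2 := measureReal_le_integral_ramp (μ := μ) hX (z := z) hl
    have h3 := integral_ramp_le_measureReal (μ := gaussianReal 0 1) measurable_id (z := z) hl
    have h4 := stdGaussian_cdf_sub_le (a := z) (b := z + l) (by linarith)
    change _ ≤ (gaussianReal 0 1).real (Set.Iic (z + l)) at h3
    simp only [id] at h3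
    linarith

/-- The extra `l` allows for an atom at `a`: the interval is covered by `(a - l, b]`, a difference
of two distribution function values. -/
lemma measureReal_preimage_Icc_le_kolmogorovToNormal {X : Ω → ℝ} (hX : Measurable X)
    {a b l : ℝ} (hab : a ≤ b) (hl : 0 < l) :
    μ.real (X ⁻¹' Set.Icc a b) ≤ 2 * kolmogorovToNormal μ X + (b - a) + l := by
  have hs : MeasurableSet {ω | X ω ≤ a - l} := measurableSet_le hX measurable_const
  have hsub : {ω | X ω ≤ a - l} ⊆ {ω | X ω ≤ b} := fun ω h => by
    simp only [Set.mem_ofPred_eq] at h ⊢; linarith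
  have h1 : μ.real (X ⁻¹' Set.Icc a b) ≤ μ.real ({ω | X ω ≤ b} \ {ω | X ω ≤ a - l}) := by
    refine measureReal_mono fun ω h => ?_
    simp only [Set.mem_preimage, Set.mem_Icc, Set.mem_sdiff, Set.mem_ofPred_eq] at h ⊢
    exact ⟨h.2, by linarith [h.1]⟩
  rw [measureReal_sdiff hsub hs] at h1
  have h2 := (abs_le.1 (abs_sub_le_kolmogorovToNormal (μ := μ) X b)).2
  have h3 := (abs_le.1 (abs_sub_le_kolmogorovToNormal (μ := μ) X (a - l))).1
  have h4 := stdGaussian_cdf_sub_le (a := a - l) (b := b) (by linarith)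
  linarith

end Kolmogorov

/-! ### Standardized variables. -/

section Standardized

variable {Θ Ω : Type*} [MeasurableSpace Θ] [MeasurableSpace Ω] {P : Kernel Θ Ω}
  {Y : Θ → Ω → ℝ} {θ : Θ}

lemma sdAt_pos (h : 0 < varAt P Y θ) : 0 < sdAt P Y θ := Real.sqrt_pos.2 h

lemma standardized_eq (h : 0 < varAt P Y θ) (ω : Ω) :
    standardized P Y θ ω = (Y θ ω - meanAt P Y θ) / sdAt P Y θ := if_pos (sdAt_pos h)

lemma measurable_standardized (hY : Measurable (Y θ)) : Measurable (standardized P Y θ) := by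
  by_cases h : 0 < sdAt P Y θ
  · have : standardized P Y θ = fun ω => (Y θ ω - meanAt P Y θ) / sdAt P Y θ :=
      funext fun ω => if_pos h
    rw [this]
    fun_prop
  · have : standardized P Y θ = fun _ => 0 := funext fun ω => if_neg h
    rw [this]
    fun_prop

variable [IsMarkovKernel P]

lemma integrable_standardized (h : 0 < varAt P Y θ) (hY2 : MemLp (Y θ) 2 (P θ)) :
    Integrable (standardized P Y θ) (P θ) := by
  rw [funext (standardized_eq h)]
  exact ((hY2.integrable one_le_two).sub (integrable_const _)).div_const _

lemma variance_standardized (h : 0 < varAt P Y θ) (hY2 : MemLp (Y θ) 2 (P θ)) :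
    variance (standardized P Y θ) (P θ) = 1 := by
  have e : standardized P Y θ = fun ω => (sdAt P Y θ)⁻¹ * (Y θ ω - meanAt P Y θ) := by
    ext ω; rw [standardized_eq h, div_eq_inv_mul]
  rw [e, variance_const_mul, variance_sub_const hY2.aestronglyMeasurable]
  change _ * varAt P Y θ = 1
  rw [inv_pow, sdAt, Real.sq_sqrt h.le, inv_mul_cancel₀ h.ne']

lemma measureReal_preimage_Icc_le_of_standardized (hY : Measurable (Y θ)) (h : 0 < varAt P Y θ)
    {a b l : ℝ} (hab : a ≤ b) (hl : 0 < l) :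
    (P θ).real (Y θ ⁻¹' Set.Icc a b) ≤
      2 * kolmogorovToNormal (P θ) (standardized P Y θ) + (b - a) / sdAt P Y θ + l := by
  have hs := sdAt_pos h
  have e : Y θ ⁻¹' Set.Icc a b = standardized P Y θ ⁻¹'
      Set.Icc ((a - meanAt P Y θ) / sdAt P Y θ) ((b - meanAt P Y θ) / sdAt P Y θ) := by
    ext ω
    simp only [Set.mem_preimage, Set.mem_Icc, standardized_eq h, div_le_div_iff_of_pos_right hs,
      sub_le_sub_iff_right]
  rw [e]
  refine (measureReal_preimage_Icc_le_kolmogorovToNormal (measurable_standardized hY)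
    ?_ hl).trans (le_of_eq ?_)
  · rw [div_le_div_iff_of_pos_right hs]; linarith
  · ring

end Standardized

/-! ### Constants extracted from finite suprema. -/

lemma exists_bound_of_iSup_mul_lt_top {ι : Type*} {S : Set ι} {a : ι → ℝ} (ha : ∀ i, 0 < a i)
    {J : ι → ℝ≥0∞} (h : (⨆ i ∈ S, ENNReal.ofReal (a i) * J i) < ∞) :
    ∃ C : ℝ, 0 ≤ C ∧ ∀ i ∈ S, J i ≤ ENNReal.ofReal (C / a i) := by
  refine ⟨(⨆ i ∈ S, ENNReal.ofReal (a i) * J i).toReal, ENNReal.toReal_nonneg, fun i hi => ?_⟩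
  rw [ENNReal.ofReal_div_of_pos (ha i), ENNReal.ofReal_toReal h.ne,
    ENNReal.le_div_iff_mul_le (Or.inl (by simpa using ha i)) (Or.inl ENNReal.ofReal_ne_top),
    mul_comm]
  exact le_iSup₂ (f := fun i (_ : i ∈ S) => ENNReal.ofReal (a i) * J i) i hi

lemma exists_bound_of_iSup_essSup_lt_top {ι Ω : Type*} [MeasurableSpace Ω] {S : Set ι}
    {μ : ι → Measure Ω} {u : ι → Ω → ℝ}
    (h : (⨆ i ∈ S, essSup (fun ω => ENNReal.ofReal (u i ω)) (μ i)) < ∞) :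
    ∃ C : ℝ, 0 ≤ C ∧ ∀ i ∈ S, ∀ᵐ ω ∂(μ i), u i ω ≤ C := by
  refine ⟨(⨆ i ∈ S, essSup (fun ω => ENNReal.ofReal (u i ω)) (μ i)).toReal,
    ENNReal.toReal_nonneg, fun i hi => ?_⟩
  filter_upwards [ENNReal.ae_le_essSup (μ := μ i) (fun ω => ENNReal.ofReal (u i ω))] with ω hω
  have h1 := hω.trans (le_iSup₂
    (f := fun i (_ : i ∈ S) => essSup (fun ω => ENNReal.ofReal (u i ω)) (μ i)) i hi)
  exact (ENNReal.ofReal_le_iff_le_toReal h.ne).1 h1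

/-! ### The recursive inequality. -/

/-- One step of the induction: a zero-bias coupling together with an embedded variable `V` whose
conditional law satisfies the concentration inequality `hconc` gives a bound on the Kolmogorov
distance. -/
lemma kolmogorovToNormal_le_of_zeroBias_coupling {Θ Ω : Type*} [MeasurableSpace Θ]
    {m mΩ : MeasurableSpace Ω} (hm : m ≤ mΩ) {μ : Measure Ω} [IsProbabilityMeasure μ]
    {W Wstar Dbar Bbar V : Ω → ℝ} {Ψ : Ω → Θ} {F₁ F₂ : Set Ω} (κ : Kernel Θ ℝ) [IsMarkovKernel κ]
    (hW : Measurable W) (hWs : Measurable Wstar) (hWi : Integrable W μ)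
    (hvar : variance W μ = 1) (hzb : IsZeroBias μ W Wstar)
    (hDm : Measurable[m] Dbar) (hD0 : ∀ᵐ ω ∂μ, 0 ≤ Dbar ω)
    (hBm : Measurable[m] Bbar) (hB0 : ∀ᵐ ω ∂μ, 0 ≤ Bbar ω)
    (hF₁ : MeasurableSet F₁) (hF₂ : MeasurableSet[m] F₂)
    (hD : ∀ᵐ ω ∂μ, ω ∈ F₁ → |Wstar ω - W ω| ≤ Dbar ω)
    (hV : Measurable V) {c σ : ℝ} (hσ : 0 < σ)
    (hB : ∀ᵐ ω ∂μ, ω ∈ F₁ → |c + σ * W ω - V ω| ≤ σ * Bbar ω)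
    (hΨ : Measurable[m] Ψ)
    (hlaw : ∀ A : Set ℝ, MeasurableSet A → ∀ᵐ ω ∂μ, ω ∈ F₂ →
      (μ⟦V ⁻¹' A | m⟧) ω = (κ (Ψ ω)).real A)
    {q s : ℝ} (hq : 0 ≤ q) (hs : 0 ≤ s)
    (hconc : ∀ᵐ ω ∂μ, ω ∈ F₂ → ∀ a b, a ≤ b → (κ (Ψ ω)).real (Set.Icc a b) ≤ q + s * ((b - a) / σ))
    {e₁ e₂ e₃ e₄ l : ℝ} (he₁ : 0 ≤ e₁) (he₂ : 0 ≤ e₂) (he₃ : 0 ≤ e₃) (he₄ : 0 ≤ e₄) (hl : 0 < l)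
    (h₁ : ∫⁻ ω in F₁ᶜ, ENNReal.ofReal |Wstar ω - W ω| ∂μ ≤ ENNReal.ofReal e₁)
    (h₂ : ∫⁻ ω in F₂ᶜ, ENNReal.ofReal |Wstar ω - W ω| ∂μ ≤ ENNReal.ofReal e₂)
    (h₃ : ∫⁻ ω, ENNReal.ofReal (|(Wstar ω - W ω) * W ω| + Dbar ω) ∂μ ≤ ENNReal.ofReal e₃)
    (h₄ : ∫⁻ ω in F₂, ENNReal.ofReal (Dbar ω * (Bbar ω + Dbar ω)) ∂μ ≤ ENNReal.ofReal e₄) :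
    kolmogorovToNormal μ W ≤
      l + (6 * e₁ + 6 * e₃ + 1 / l * (e₁ + e₂ + ((q + s * l) * e₃ + 2 * s * e₄))) := by
  have hDm' : Measurable Dbar := hDm.mono hm le_rfl
  have hF₂' : MeasurableSet F₂ := hm _ hF₂
  refine kolmogorovToNormal_le_of_ramp hW hl fun z => ?_
  have hA := abs_integral_sub_gaussian_le_of_isZeroBias hW hWs hWi hvar hzb (continuous_ramp z l)
    (ramp_nonneg z l) (ramp_le_one z l)
  have hT : ∫⁻ ω, ENNReal.ofReal (6 * |Wstar ω - W ω| + 2 * |(Wstar ω - W ω) * W ω|) ∂μ ≤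
      ENNReal.ofReal (6 * e₁ + 6 * e₃) := by
    calc _ ≤ ∫⁻ ω, (6 * F₁ᶜ.indicator (fun ω => ENNReal.ofReal |Wstar ω - W ω|) ω +
          6 * ENNReal.ofReal (|(Wstar ω - W ω) * W ω| + Dbar ω)) ∂μ := by
          refine lintegral_mono_ae ?_
          filter_upwards [hD, hD0] with ω h1 h2
          have e6 : (6 : ℝ≥0∞) = ENNReal.ofReal 6 := by simp
          have p := abs_nonneg ((Wstar ω - W ω) * W ω)
          by_cases hω : ω ∈ F₁
          · rw [Set.indicator_of_notMem (by simpa using hω), mul_zero, zero_add, e6,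
              ← ENNReal.ofReal_mul (by norm_num)]
            apply ENNReal.ofReal_le_ofReal
            linarith [h1 hω]
          · rw [Set.indicator_of_mem (by simpa using hω), ← mul_add, e6,
              ← ENNReal.ofReal_add (abs_nonneg _) (by positivity),
              ← ENNReal.ofReal_mul (by norm_num)]
            apply ENNReal.ofReal_le_ofReal
            linarith
      _ ≤ 6 * ENNReal.ofReal e₁ + 6 * ENNReal.ofReal e₃ := by
          rw [lintegral_add_left (by fun_prop (disch := measurability)),
            lintegral_const_mul _ (by fun_prop (disch := measurability)),
            lintegral_const_mul _ (by fun_prop), lintegral_indicator hF₁.compl]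
          gcongr
      _ = _ := by
          rw [ENNReal.ofReal_add (by positivity) (by positivity),
            ENNReal.ofReal_mul (by norm_num), ENNReal.ofReal_mul (by norm_num)]
          simp
  -- The window for `W`, rescaled to that of `c + σ W` and widened by `σ * Bbar` to catch `V`. Its
  -- endpoints are `m`-measurable; `F₁` need not be, so its indicator is dropped before
  -- conditioning.
  set a : Ω → ℝ := fun ω => c + σ * (z - Dbar ω - Bbar ω) with ha
  set b : Ω → ℝ := fun ω => c + σ * (z + l + Dbar ω + Bbar ω) with hb
  have ham : Measurable[m] a := by fun_prop
  have hbm : Measurable[m] b := by fun_prop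
  have hI : ∫⁻ ω in F₂, ENNReal.ofReal (Dbar ω) * (Set.Icc (a ω) (b ω)).indicator 1 (V ω) ∂μ ≤
      ENNReal.ofReal ((q + s * l) * e₃ + 2 * s * e₄) := by
    rw [setLIntegral_mul_indicator_Icc_of_condLaw hm κ hV hDm ham hbm hΨ hF₂ hlaw]
    calc _ ≤ ∫⁻ ω in F₂, (ENNReal.ofReal (q + s * l) *
            ENNReal.ofReal (|(Wstar ω - W ω) * W ω| + Dbar ω) +
            ENNReal.ofReal (2 * s) * ENNReal.ofReal (Dbar ω * (Bbar ω + Dbar ω))) ∂μ := by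
          refine lintegral_mono_ae ((ae_restrict_iff' hF₂').2 ?_)
          filter_upwards [hconc, hD0, hB0] with ω hc h0 hB0 hω
          have hab : a ω ≤ b ω := by
            simp only [ha, hb]
            gcongr
            linarith
          have hba : (b ω - a ω) / σ = l + 2 * Dbar ω + 2 * Bbar ω := by
            simp only [ha, hb]; field_simp; ring
          have := hc hω _ _ hab
          rw [hba] at this
          have p := abs_nonneg ((Wstar ω - W ω) * W ω)
          rw [← ofReal_measureReal, ← ENNReal.ofReal_mul h0, ← ENNReal.ofReal_mul (by positivity),
            ← ENNReal.ofReal_mul (by positivity), ← ENNReal.ofReal_add (by positivity)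
            (by positivity)]
          apply ENNReal.ofReal_le_ofReal
          have p1 := mul_le_mul_of_nonneg_left this h0
          have p2 : 0 ≤ (q + s * l) * |(Wstar ω - W ω) * W ω| := by positivity
          linarith
      _ ≤ ENNReal.ofReal (q + s * l) * ENNReal.ofReal e₃ +
            ENNReal.ofReal (2 * s) * ENNReal.ofReal e₄ := by
          rw [lintegral_add_left (by fun_prop), lintegral_const_mul _ (by fun_prop),
            lintegral_const_mul' _ _ ENNReal.ofReal_ne_top]
          gcongr
          exact (setLIntegral_le_lintegral _ _).trans h₃
      _ = _ := by
          rw [ENNReal.ofReal_add (p := (q + s * l) * e₃) (by positivity) (by positivity),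
            ENNReal.ofReal_mul (p := q + s * l) (by positivity),
            ENNReal.ofReal_mul (p := 2 * s) (by positivity)]
  have hR : ∫⁻ ω, ENNReal.ofReal |ramp z l (Wstar ω) - ramp z l (W ω)| ∂μ ≤
      ENNReal.ofReal (1 / l * (e₁ + e₂ + ((q + s * l) * e₃ + 2 * s * e₄))) := by
    calc _ ≤ ∫⁻ ω, ENNReal.ofReal (1 / l) *
          (F₁ᶜ.indicator (fun ω => ENNReal.ofReal |Wstar ω - W ω|) ω +
            F₂ᶜ.indicator (fun ω => ENNReal.ofReal |Wstar ω - W ω|) ω +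
            F₂.indicator (fun ω => ENNReal.ofReal (Dbar ω) *
              (Set.Icc (a ω) (b ω)).indicator 1 (V ω)) ω) ∂μ := by
          refine lintegral_mono_ae ?_
          filter_upwards [hD, hD0, hB, hB0] with ω hD hD0 hB hB0
          have hlip : ENNReal.ofReal |ramp z l (Wstar ω) - ramp z l (W ω)| ≤
              ENNReal.ofReal (1 / l) * ENNReal.ofReal |Wstar ω - W ω| := by
            rw [← ENNReal.ofReal_mul (by positivity)]
            apply ENNReal.ofReal_le_ofReal
            rw [one_div_mul_eq_div]
            exact abs_ramp_sub_le hl _ _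
          by_cases hω₁ : ω ∈ F₁
          swap
          · refine hlip.trans ?_
            gcongr
            rw [Set.indicator_of_mem (by simpa using hω₁), add_assoc]
            exact le_self_add
          by_cases hω₂ : ω ∈ F₂
          swap
          · refine hlip.trans ?_
            gcongr
            rw [Set.indicator_of_mem (s := F₂ᶜ) (by simpa using hω₂), add_comm (F₁ᶜ.indicator _ _),
              add_assoc]
            exact le_self_add
          rw [Set.indicator_of_notMem (s := F₁ᶜ) (by simpa using hω₁),
            Set.indicator_of_notMem (s := F₂ᶜ) (by simpa using hω₂), Set.indicator_of_mem hω₂,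
            zero_add, zero_add]
          have hi := abs_ramp_sub_le_indicator (z := z) hl (hD hω₁)
          by_cases hx : W ω ∈ Set.Icc (z - Dbar ω) (z + l + Dbar ω)
          · have hVI : V ω ∈ Set.Icc (a ω) (b ω) := by
              have h1 := abs_le.1 (hB hω₁)
              have h2 := mul_le_mul_of_nonneg_left hx.1 hσ.le
              have h3 := mul_le_mul_of_nonneg_left hx.2 hσ.le
              simp only [ha, hb, Set.mem_Icc]
              constructor <;> linarith [h1.1, h1.2]
            rw [Set.indicator_of_mem hVI, Pi.one_apply, mul_one]
            refine hlip.trans ?_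
            gcongr
            exact hD hω₁
          · rw [Set.indicator_of_notMem hx, mul_zero] at hi
            rw [ENNReal.ofReal_of_nonpos hi]
            exact zero_le
      _ ≤ ENNReal.ofReal (1 / l) * (ENNReal.ofReal e₁ + ENNReal.ofReal e₂ +
            ENNReal.ofReal ((q + s * l) * e₃ + 2 * s * e₄)) := by
          rw [lintegral_const_mul' _ _ ENNReal.ofReal_ne_top,
            lintegral_add_left (by fun_prop (disch := measurability)),
            lintegral_add_left (by fun_prop (disch := measurability)),
            lintegral_indicator hF₁.compl, lintegral_indicator hF₂'.compl, lintegral_indicator hF₂']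
          gcongr
      _ = _ := by
          rw [ENNReal.ofReal_mul (p := 1 / l) (by positivity),
            ENNReal.ofReal_add (p := e₁ + e₂) (by positivity) (by positivity),
            ENNReal.ofReal_add he₁ he₂]
  have := hA.trans (add_le_add hT hR)
  rw [← ENNReal.ofReal_add (by positivity) (by positivity)] at this
  exact (ENNReal.ofReal_le_ofReal_iff (by positivity)).1 this

/-! ### Solving the recursion. -/

/-- A self-improving bound `δ θ ≲ 1 / r θ + M / (l * r θ)`, where `M` bounds `δ` at all parameters
of comparable rate, forces `δ θ ≲ 1 / r θ`. -/
lemma exists_rate_of_truncated_recursion {Θ : Type*} {r δ : Θ → ℝ}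
    {rbar t C₁ C₂ C₃ C₄ s : ℝ} (hr_pos : ∀ θ, 0 < r θ) (hrbar : 0 < rbar) (ht : 0 ≤ t)
    (hC₁ : 0 ≤ C₁) (hC₂ : 0 ≤ C₂) (hC₃ : 0 ≤ C₃) (hC₄ : 0 ≤ C₄) (hs : 0 ≤ s)
    (hδ0 : ∀ θ, 0 ≤ δ θ) (hδ1 : ∀ θ, δ θ ≤ 1)
    (step : ∀ θ ∈ goodSet r rbar, ∀ M l : ℝ, 0 ≤ M → 0 < l →
      (∀ θ' ∈ goodSet r rbar, r θ ≤ t * r θ' → δ θ' ≤ M) →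
      δ θ ≤ l + (6 * (C₁ / r θ ^ 2) + 6 * (C₃ / r θ) + 1 / l * (C₁ / r θ ^ 2 + C₂ / r θ ^ 2 +
        ((2 * M + l + t * rbar / r θ + s * l) * (C₃ / r θ) + 2 * s * (C₄ / r θ ^ 2))))) :
    ∃ A : ℝ, 0 ≤ A ∧ ∀ θ ∈ goodSet r rbar, r θ * δ θ ≤ A := by
  set c := max t 1 with hc
  have hc1 : 1 ≤ c := le_max_right _ _
  have hct : t ≤ c := le_max_left _ _
  -- With `l = K / r θ` the unknown returns with factor `2 * c * C₃ / K`, which this choice makes at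
  -- most `1 / 2`.
  set K := 4 * c * C₃ + 1 with hK
  have hKpos : 0 < K := by positivity
  set A := K + 6 * C₁ / rbar + 6 * C₃ +
    1 / K * (C₁ + C₂ + (K + t * rbar + s * K) * C₃ + 2 * s * C₄) with hAdef
  have hA : 0 ≤ A := by positivity
  have improve : ∀ R : ℝ, 0 < R → ∀ S : ℝ, 0 ≤ S →
      (∀ θ ∈ goodSet r rbar, min (r θ) R * δ θ ≤ S) →
      ∀ θ ∈ goodSet r rbar, min (r θ) R * δ θ ≤ A + S / 2 := by
    intro R hR S hS hind θ hθ
    have hrθ := hr_pos θ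
    have hgood : rbar < r θ := hθ
    set ρ := min (r θ) R with hρ
    have hρ0 : 0 < ρ := lt_min hrθ hR
    have hρr : ρ ≤ r θ := min_le_left _ _
    -- Truncation preserves comparability: `r θ ≤ t * r θ'` gives `min (r θ) R ≤ c * min (r θ') R`
    -- because `c ≥ 1`. Hence the bound `S` at `θ'` yields `M = S * c / ρ`.
    have h := step θ hθ (S * c / ρ) (K / r θ) (by positivity) (by positivity) fun θ' hθ' hle => by
      have hρ' : 0 < min (r θ') R := lt_min (hr_pos θ') hR
      have h1 : ρ ≤ c * min (r θ') R := by
        rw [mul_min_of_nonneg _ _ (by positivity)]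
        refine min_le_min (hle.trans (mul_le_mul_of_nonneg_right hct (hr_pos θ').le)) ?_
        nlinarith
      rw [le_div_iff₀ hρ0]
      have h2 := hind θ' hθ'
      have h3 := mul_le_mul_of_nonneg_left h1 (hδ0 θ')
      nlinarith
    have h4 := mul_le_mul_of_nonneg_left h hρ0.le
    refine h4.trans ?_
    have e : ρ * (K / r θ + (6 * (C₁ / r θ ^ 2) + 6 * (C₃ / r θ) +
        1 / (K / r θ) * (C₁ / r θ ^ 2 + C₂ / r θ ^ 2 +
        ((2 * (S * c / ρ) + K / r θ + t * rbar / r θ + s * (K / r θ)) * (C₃ / r θ) +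
          2 * s * (C₄ / r θ ^ 2))))) =
        ρ / r θ * (K + 6 * C₁ / r θ + 6 * C₃ +
          1 / K * (C₁ + C₂ + (K + t * rbar + s * K) * C₃ + 2 * s * C₄)) +
        2 * c * C₃ / K * S := by
      field_simp
      ring
    rw [e]
    have h5 : K + 6 * C₁ / r θ + 6 * C₃ +
        1 / K * (C₁ + C₂ + (K + t * rbar + s * K) * C₃ + 2 * s * C₄) ≤ A := by
      rw [hAdef]
      gcongr
    have h6 : ρ / r θ ≤ 1 := (div_le_one hrθ).2 hρr
    have h7 : 2 * c * C₃ / K ≤ 1 / 2 := by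
      rw [div_le_div_iff₀ hKpos two_pos, hK]
      linarith
    have h8 := mul_le_mul h6 h5 (by positivity) zero_le_one
    have h9 := mul_le_mul_of_nonneg_right h7 hS
    linarith
  refine ⟨2 * A, by positivity, fun θ hθ => ?_⟩
  have hrθ := hr_pos θ
  -- Truncating at `R = r θ` makes `δ ≤ 1` a valid start. Iterating `S ↦ A + S / 2` then converges
  -- to its fixed point `2 * A`, which is free of `R`.
  have hn : ∀ n : ℕ, ∀ θ' ∈ goodSet r rbar,
      min (r θ') (r θ) * δ θ' ≤ 2 * A + r θ * (1 / 2) ^ n := by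
    intro n
    induction n with
    | zero =>
      intro θ' _
      have h1 : min (r θ') (r θ) * δ θ' ≤ r θ * 1 :=
        mul_le_mul (min_le_right _ _) (hδ1 θ') (hδ0 θ') hrθ.le
      rw [pow_zero]
      linarith
    | succ n ih =>
      intro θ' hθ'
      refine (improve (r θ) hrθ _ (by positivity) ih θ' hθ').trans (le_of_eq ?_)
      ring
  have hlim : Filter.Tendsto (fun n : ℕ => 2 * A + r θ * (1 / 2 : ℝ) ^ n) Filter.atTop
      (nhds (2 * A + r θ * 0)) :=
    ((tendsto_pow_atTop_nhds_zero_of_lt_one (by norm_num) (by norm_num)).const_mul _).const_add _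
  rw [mul_zero, add_zero] at hlim
  refine ge_of_tendsto' hlim fun n => ?_
  simpa using hn n θ hθ

/-! ### The main theorem. -/

theorem theorem2
    -- parameter space, sample space, transition kernel
    {Θ Ω : Type*} [MeasurableSpace Θ] [mΩ : MeasurableSpace Ω]
    (P : Kernel Θ Ω) [IsMarkovKernel P]
    -- random variables are jointly measurable functions of `(θ, ω)`
    (Y Wstar Dbar V Bbar : Θ → Ω → ℝ) (Ψ : Θ → Ω → Θ)
    (hY : Measurable (fun p : Θ × Ω => Y p.1 p.2))
    (hWstar : Measurable (fun p : Θ × Ω => Wstar p.1 p.2))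
    (hDbar : Measurable (fun p : Θ × Ω => Dbar p.1 p.2))
    (hV : Measurable (fun p : Θ × Ω => V p.1 p.2))
    (hBbar : Measurable (fun p : Θ × Ω => Bbar p.1 p.2))
    (hΨ : Measurable (fun p : Θ × Ω => Ψ p.1 p.2))
    (hY2 : ∀ θ, MemLp (Y θ) 2 (P θ))
    -- (Z1): rate function and threshold
    (r : Θ → ℝ) (hr : Measurable r) (hr_pos : ∀ θ, 0 < r θ)
    (rbar : ℝ) (hrbar : 0 < rbar)
    (hvar : ∀ θ ∈ goodSet r rbar, 0 < varAt P Y θ)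
    -- (Z2): zero bias coupling
    (hzb : ∀ θ ∈ goodSet r rbar, IsZeroBias (P θ) (standardized P Y θ) (Wstar θ))
    -- (Z3): majorant of `D = Wstar - W` on `F₁`
    (ℱ : Θ → MeasurableSpace Ω) (hℱ : ∀ θ ∈ goodSet r rbar, ℱ θ ≤ mΩ)
    (hDbar_meas : ∀ θ ∈ goodSet r rbar, Measurable[ℱ θ] (Dbar θ))
    (hDbar_nonneg : ∀ θ ∈ goodSet r rbar, ∀ᵐ ω ∂(P θ), 0 ≤ Dbar θ ω)
    (F₁ : Θ → Set Ω) (hF₁ : ∀ θ ∈ goodSet r rbar, MeasurableSet (F₁ θ))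
    (hD_le : ∀ θ ∈ goodSet r rbar, ∀ᵐ ω ∂(P θ), ω ∈ F₁ θ →
      |Wstar θ ω - standardized P Y θ ω| ≤ Dbar θ ω)
    (hD_F₁ : (⨆ θ ∈ goodSet r rbar, ENNReal.ofReal (r θ ^ 2) *
      ∫⁻ ω in (F₁ θ)ᶜ, ENNReal.ofReal |Wstar θ ω - standardized P Y θ ω| ∂(P θ)) < ∞)
    (hDW : (⨆ θ ∈ goodSet r rbar, ENNReal.ofReal (r θ) *
      ∫⁻ ω, ENNReal.ofReal
        (|(Wstar θ ω - standardized P Y θ ω) * standardized P Y θ ω| + Dbar θ ω) ∂(P θ)) < ∞)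
    -- (Z4): embedded variable
    (hΨ_meas : ∀ θ ∈ goodSet r rbar, Measurable[ℱ θ] (Ψ θ))
    (F₂ : Θ → Set Ω) (hF₂ : ∀ θ ∈ goodSet r rbar, MeasurableSet[ℱ θ] (F₂ θ))
    (hlaw : ∀ θ ∈ goodSet r rbar, ∀ A : Set ℝ, MeasurableSet A →
      ∀ᵐ ω ∂(P θ), ω ∈ F₂ θ →
        ((P θ)⟦V θ ⁻¹' A | ℱ θ⟧) ω = (P (Ψ θ ω)).real (Y (Ψ θ ω) ⁻¹' A))
    (hD_F₂ : (⨆ θ ∈ goodSet r rbar, ENNReal.ofReal (r θ ^ 2) *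
      ∫⁻ ω in (F₂ θ)ᶜ, ENNReal.ofReal |Wstar θ ω - standardized P Y θ ω| ∂(P θ)) < ∞)
    -- (Z5): bound on `|Y - V|`
    (hBbar_meas : ∀ θ ∈ goodSet r rbar, Measurable[ℱ θ] (Bbar θ))
    (hBbar_nonneg : ∀ θ ∈ goodSet r rbar, ∀ᵐ ω ∂(P θ), 0 ≤ Bbar θ ω)
    (hB_le : ∀ θ ∈ goodSet r rbar, ∀ᵐ ω ∂(P θ), ω ∈ F₁ θ →
      (sdAt P Y θ)⁻¹ * |Y θ ω - V θ ω| ≤ Bbar θ ω)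
    (hDB : (⨆ θ ∈ goodSet r rbar, ENNReal.ofReal (r θ ^ 2) *
      ∫⁻ ω in F₂ θ, ENNReal.ofReal (Dbar θ ω * (Bbar θ ω + Dbar θ ω)) ∂(P θ)) < ∞)
    -- (G7): comparison of variances and rates
    (hσ_ratio : (⨆ θ ∈ goodSet r rbar,
      essSup (fun ω => ENNReal.ofReal (varAt P Y θ / varAt P Y (Ψ θ ω)))
        ((P θ).restrict (F₂ θ ∩ {ω | Ψ θ ω ∈ goodSet r rbar}))) < ∞)
    (hr_ratio : (⨆ θ ∈ goodSet r rbar,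
      essSup (fun ω => ENNReal.ofReal (r θ / r (Ψ θ ω))) ((P θ).restrict (F₂ θ))) < ∞)
    (hr_ratio' : (⨆ θ ∈ goodSet r rbar,
      essSup (fun ω => ENNReal.ofReal (r (Ψ θ ω) / r θ))
        ((P θ).restrict (F₂ θ ∩ {ω | Ψ θ ω ∈ goodSet r rbar}))) < ∞) :
    ∃ C : ℝ, ∀ θ, kolmogorovToNormal (P θ) (standardized P Y θ) ≤ C / r θ := by
  obtain ⟨C₁, hC₁, h₁⟩ := exists_bound_of_iSup_mul_lt_top (fun θ => pow_pos (hr_pos θ) 2) hD_F₁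
  obtain ⟨C₂, hC₂, h₂⟩ := exists_bound_of_iSup_mul_lt_top (fun θ => pow_pos (hr_pos θ) 2) hD_F₂
  obtain ⟨C₃, hC₃, h₃⟩ := exists_bound_of_iSup_mul_lt_top hr_pos hDW
  obtain ⟨C₄, hC₄, h₄⟩ := exists_bound_of_iSup_mul_lt_top (fun θ => pow_pos (hr_pos θ) 2) hDB
  obtain ⟨v, hv, hvb⟩ := exists_bound_of_iSup_essSup_lt_top hσ_ratio
  obtain ⟨t, ht, htb⟩ := exists_bound_of_iSup_essSup_lt_top hr_ratio
  obtain ⟨κ, hκ, hκY⟩ := exists_law_kernel P hY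
  have hYm : ∀ θ, Measurable (Y θ) := fun θ => hY.comp measurable_prodMk_left
  set δ : Θ → ℝ := fun θ => kolmogorovToNormal (P θ) (standardized P Y θ) with hδ
  have hκr : ∀ θ A, MeasurableSet A → (κ θ).real A = (P θ).real (Y θ ⁻¹' A) := fun θ A hA => by
    rw [measureReal_def, measureReal_def, hκY θ A hA]
  -- The condition `r θ ≤ t * r θ'` holds at `θ' = Ψ θ ω` for almost every `ω` in `F₂ θ`. The factor
  -- `√v` converts lengths in units of the standard deviation at `Ψ` to units of that at `θ`.
  have step : ∀ θ ∈ goodSet r rbar, ∀ M l : ℝ, 0 ≤ M → 0 < l →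
      (∀ θ' ∈ goodSet r rbar, r θ ≤ t * r θ' → δ θ' ≤ M) →
      δ θ ≤ l + (6 * (C₁ / r θ ^ 2) + 6 * (C₃ / r θ) + 1 / l * (C₁ / r θ ^ 2 + C₂ / r θ ^ 2 +
        ((2 * M + l + t * rbar / r θ + √v * l) * (C₃ / r θ) + 2 * √v * (C₄ / r θ ^ 2)))) := by
    intro θ hθ M l hM hl hδM
    have hrθ := hr_pos θ
    have hσ := sdAt_pos (hvar θ hθ)
    have hF₂' := hℱ θ hθ _ (hF₂ θ hθ)
    refine kolmogorovToNormal_le_of_zeroBias_coupling (hℱ θ hθ) κ (measurable_standardized (hYm θ))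
      (hWstar.comp measurable_prodMk_left) (integrable_standardized (hvar θ hθ) (hY2 θ))
      (variance_standardized (hvar θ hθ) (hY2 θ)) (hzb θ hθ) (hDbar_meas θ hθ) (hDbar_nonneg θ hθ)
      (hBbar_meas θ hθ) (hBbar_nonneg θ hθ) (hF₁ θ hθ) (hF₂ θ hθ) (hD_le θ hθ)
      (V := V θ) (hV.comp measurable_prodMk_left) (c := meanAt P Y θ) hσ ?_ (hΨ_meas θ hθ) ?_
      (by positivity) (Real.sqrt_nonneg v) ?_ (by positivity) (by positivity) (by positivity)
      (by positivity) hl (h₁ θ hθ) (h₂ θ hθ) (h₃ θ hθ) (h₄ θ hθ)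
    · filter_upwards [hB_le θ hθ] with ω hω hF
      rw [standardized_eq (hvar θ hθ), mul_div_cancel₀ _ hσ.ne', add_sub_cancel,
        ← inv_mul_le_iff₀ hσ]
      exact hω hF
    · intro A hA
      filter_upwards [hlaw θ hθ A hA] with ω hω hF
      rw [hω hF, hκr _ _ hA]
    · have hmG : MeasurableSet (F₂ θ ∩ {ω | Ψ θ ω ∈ goodSet r rbar}) :=
        hF₂'.inter (measurableSet_lt measurable_const
          (hr.comp ((hΨ_meas θ hθ).mono (hℱ θ hθ) le_rfl)))
      filter_upwards [(ae_restrict_iff' hmG).1 (hvb θ hθ), (ae_restrict_iff' hF₂').1 (htb θ hθ)]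
        with ω hv1 ht1 hF a b hab
      rw [hκr _ _ measurableSet_Icc]
      have htr : r θ ≤ t * r (Ψ θ ω) := (div_le_iff₀ (hr_pos _)).1 (ht1 hF)
      have hba : 0 ≤ (b - a) / sdAt P Y θ := div_nonneg (sub_nonneg.2 hab) hσ.le
      by_cases hG : Ψ θ ω ∈ goodSet r rbar
      · have hvΨ := hvar _ hG
        have hσΨ := sdAt_pos hvΨ
        have hs : sdAt P Y θ / sdAt P Y (Ψ θ ω) ≤ √v := by
          rw [sdAt, sdAt, ← Real.sqrt_div' _ hvΨ.le]
          exact Real.sqrt_le_sqrt (hv1 ⟨hF, hG⟩)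
        have h5 := measureReal_preimage_Icc_le_of_standardized (hYm (Ψ θ ω)) hvΨ hab hl
        have h6 : (b - a) / sdAt P Y (Ψ θ ω) ≤ √v * ((b - a) / sdAt P Y θ) := by
          calc _ = sdAt P Y θ / sdAt P Y (Ψ θ ω) * ((b - a) / sdAt P Y θ) := by field_simp
            _ ≤ _ := mul_le_mul_of_nonneg_right hs hba
        have h7 := hδM _ hG htr
        have h8 : 0 ≤ t * rbar / r θ := by positivity
        simp only [hδ] at h7
        linarith
      -- Here `Y` at `Ψ` may be degenerate and no concentration is available. But a small rate at
      -- `Ψ` forces a small rate at `θ`, so the term `t * rbar / r θ` already dominates any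
      -- probability.
      · have hle : r (Ψ θ ω) ≤ rbar := not_lt.1 hG
        have h9 : 1 ≤ t * rbar / r θ := by
          rw [one_le_div hrθ]
          exact htr.trans (mul_le_mul_of_nonneg_left hle ht)
        have h10 : (P (Ψ θ ω)).real (Y (Ψ θ ω) ⁻¹' Set.Icc a b) ≤ 1 := measureReal_le_one
        have h11 : 0 ≤ √v * ((b - a) / sdAt P Y θ) := by positivity
        linarith
  obtain ⟨A, hA, hrec⟩ := exists_rate_of_truncated_recursion hr_pos hrbar ht hC₁ hC₂ hC₃ hC₄
    (Real.sqrt_nonneg v) (fun θ => kolmogorovToNormal_nonneg (P θ) (standardized P Y θ))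
    (fun θ => kolmogorovToNormal_le_one (μ := P θ) (standardized P Y θ)) step
  refine ⟨max A rbar, fun θ => ?_⟩
  rw [le_div_iff₀ (hr_pos θ), mul_comm]
  by_cases hθ : θ ∈ goodSet r rbar
  · exact (hrec θ hθ).trans (le_max_left _ _)
  · have hle : r θ ≤ rbar := not_lt.1 hθ
    have h12 := mul_le_mul_of_nonneg_left
      (kolmogorovToNormal_le_one (μ := P θ) (standardized P Y θ)) (hr_pos θ).le
    exact (h12.trans (by linarith)).trans (le_max_right _ _)
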